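/- For every $\varepsilon>0$ there exists $c>0$, depending only on $\varepsilon$, such that the following holds. Let $G$ be a $d$-regular (finite, simple) graph on $n$ vertices with $(\frac12+\varepsilon)n\le d\le(1-\varepsilon)n$. Let $\mathrm{sp}(G)$ denote the surplus of $G$, that is, the maximum $s$ such that $V(G)$ has a partition into two parts with $\frac m2+s$ edges between the parts, where $m=\frac{nd}{2}$ is the number of edges of $G$. Then $$\mathrm{sp}(G)\ \ge\ \frac{c\,n^{5/4}}{\log n}.$$ Equivalently, $G$ has a cut with at least $\frac{nd}{4}+\frac{c\,n^{5/4}}{\log n}$ edges. -/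

import Mathlib

namespace SimpleGraph

variable {V : Type*} [Fintype V] [DecidableEq V] (G : SimpleGraph V) [DecidableRel G.Adj]

/-- The number of edges of `G` between the two parts of the partition `(S, Sᶜ)` of the vertex set.
Every such edge is counted once, as the pair whose first entry is its end in `S`. -/
def cutSize (S : Finset V) : ℕ :=
  (G.interedges S Sᶜ).card

/-- The surplus of a finite graph `G` with `m` edges: the maximum real number `s` such that the
vertex set has a partition into two parts `S, Sᶜ` with `m / 2 + s` edges between the parts. -/
noncomputable def surplus : ℝ :=
  Finset.univ.sup' Finset.univ_nonempty
    (fun S : Finset V => (G.cutSize S : ℝ) - (G.edgeFinset.card : ℝ) / 2)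

end SimpleGraph

/-! Write `q = d / n` and `B = q J - A`, with `A` the adjacency matrix and `J` the all-ones matrix.
Two facts combine: the semidefinite maximum `S` of `⟨B, X⟩` over positive semidefinite `X` with
diagonal at most one has order at least `n^(4/3)`, and rounding shows that the surplus is at least
of order `S / log n`. For the first (`pow_four_le_of_semidefinite_bound`), split `B = P - M` into
positive and negative parts; `‖P‖² + ‖M‖² = q(1-q)n²` in Frobenius norm. Testing with the spectral
projection and with `P²/n` bounds `tr P` and `tr P³`, hence `‖P‖² ≤ √n S`, which settles the case of
large `‖P‖`. Otherwise `M` dominates. As `B` is two-valued, its entrywise square is affine in `B`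
with slope `2q - 1 ≥ 2ε`, and this makes `⟨B, M ∘ M⟩` of order `n²`. The Schur square `M ∘ M`,
truncated to rows of small diagonal, is then a good test matrix (`pow_three_ge_of_hadamard_sq`). For
the second (`semidefinite_le_log_mul_surplus`), centre the Gram vectors to remove `J`, project on
random signs and truncate at order `√(log n)`. -/

namespace SpectralSurplus

open Matrix Finset

/-! ### Lower bound for the semidefinite value -/

section Spectral

variable {V : Type*} [Fintype V]

/-- The spectral projection of a symmetric matrix onto its nonnegative eigenspaces. -/
theorem exists_spectral_projection [DecidableEq V] {B : Matrix V V ℝ} (hB : B.IsHermitian) :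
    ∃ E : Matrix V V ℝ, E.PosSemidef ∧ E * E = E ∧ E * B = B * E ∧
      (E * B).PosSemidef ∧ (E * B - B).PosSemidef ∧ (1 - E).PosSemidef := by
  set φ := Unitary.conjStarAlgAut ℝ (Matrix V V ℝ) hB.eigenvectorUnitary with hφ
  have hpos : ∀ f : V → ℝ, (∀ i, 0 ≤ f i) → (φ (diagonal f)).PosSemidef := by
    intro f hf
    rw [hφ, Unitary.conjStarAlgAut_apply]
    exact (PosSemidef.diagonal (d := f) hf).mul_mul_conjTranspose_same _
  have hBφ : B = φ (diagonal hB.eigenvalues) := hB.spectral_theorem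
  set l := hB.eigenvalues with hl
  refine ⟨φ (diagonal fun i => if 0 ≤ l i then 1 else 0), ?_, ?_, ?_, ?_, ?_, ?_⟩
  · exact hpos _ fun i => by split_ifs <;> norm_num
  · rw [← map_mul, diagonal_mul_diagonal]; congr 2; ext i; split_ifs <;> norm_num
  · rw [hBφ, ← map_mul, ← map_mul, diagonal_mul_diagonal, diagonal_mul_diagonal]
    congr 2; ext i; ring
  · rw [hBφ, ← map_mul, diagonal_mul_diagonal]
    exact hpos _ fun i => by split_ifs with h <;> simp [h]
  · rw [hBφ, ← map_mul, ← map_sub, diagonal_mul_diagonal, diagonal_sub]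
    exact hpos _ fun i => by
      split_ifs with h
      · simp
      · simp only [zero_mul, zero_sub]; linarith
  · rw [← map_one φ, ← map_sub, ← diagonal_one, diagonal_sub]
    exact hpos _ fun i => by split_ifs <;> norm_num

theorem sum_mul_eq_trace (B X : Matrix V V ℝ) (hX : X.IsHermitian) :
    ∑ i, ∑ j, B i j * X i j = (B * X).trace := by
  simp only [trace, Matrix.diag, mul_apply]
  refine sum_congr rfl fun i _ => sum_congr rfl fun j _ => ?_
  rw [← hX.apply i j]; simp

theorem sq_apply_diag {X : Matrix V V ℝ} (hX : X.IsHermitian) (i : V) :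
    (X * X) i i = ∑ j, X i j ^ 2 := by
  rw [mul_apply]
  refine sum_congr rfl fun j _ => ?_
  rw [← hX.apply j i]; simp [sq]

/-- If the pairing of `B` with the Hadamard square of a positive semidefinite matrix of small trace
is large, then restricting to the rows of small diagonal gives a large semidefinite value. -/
theorem pow_three_ge_of_hadamard_sq [DecidableEq V] {B M : Matrix V V ℝ} {n ε S : ℝ} (hn0 : 0 < n) (hS : 0 < S)
    (hε : 0 < ε) (hM : M.PosSemidef) (habs : ∀ i j, |B i j| ≤ 1)
    (hMrow : ∀ i, ∑ j, M i j ^ 2 ≤ n) (htrM : M.trace ≤ S)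
    (hFlow : ε ^ 2 / 4 * n ^ 2 ≤ ∑ i, ∑ j, B i j * M i j ^ 2)
    (hsdp : ∀ X : Matrix V V ℝ, X.PosSemidef → (∀ i, X i i ≤ 1) →
      ∑ i, ∑ j, B i j * X i j ≤ S) :
    ε ^ 6 / 2048 * n ^ 4 ≤ S ^ 3 := by
  set F := ∑ i, ∑ j, B i j * M i j ^ 2 with hF
  -- discard the rows with a large diagonal entry
  set t := 16 * S / (ε ^ 2 * n) with ht
  have ht0 : 0 < t := by positivity
  set T : Finset V := univ.filter fun i => t < M i i with hT
  set w : V → ℝ := fun i => if t < M i i then 0 else 1 with hw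
  have hcard : (T.card : ℝ) * t ≤ S := by
    calc (T.card : ℝ) * t = ∑ i ∈ T, t := by simp
      _ ≤ ∑ i ∈ T, M i i := sum_le_sum fun i hi => (by simpa [hT] using hi : t < M i i).le
      _ ≤ ∑ i, M i i := sum_le_sum_of_subset_of_nonneg (subset_univ _)
          fun i _ _ => hM.diag_nonneg
      _ ≤ S := htrM
  -- The choice of `t` comes from here: dropping rows and columns in `T` costs at most `2 |T| n ≤ ε²
  -- n² / 8`, half of the lower bound `hFlow`.
  have hcard' : (T.card : ℝ) * n ≤ ε ^ 2 / 16 * n ^ 2 := by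
    have : (T.card : ℝ) * t = (T.card : ℝ) * n * (16 * S / (ε ^ 2 * n ^ 2)) := by
      rw [ht]; field_simp
    rw [this, ← le_div_iff₀ (by positivity)] at hcard
    refine hcard.trans_eq ?_
    field_simp
  set X : Matrix V V ℝ := (t ^ 2)⁻¹ •
    ((diagonal w * M * diagonal w) ⊙ (diagonal w * M * diagonal w)) with hX
  have hXapp : ∀ i j, X i j = (t ^ 2)⁻¹ * (w i * w j * M i j ^ 2) := by
    intro i j
    have hww : ∀ i, w i * w i = w i := fun i => by simp only [hw]; split_ifs <;> simp
    simp only [hX, Matrix.smul_apply, hadamard_apply, mul_diagonal, diagonal_mul, smul_eq_mul]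
    congr 1
    calc w i * M i j * w j * (w i * M i j * w j)
        = (w i * w i) * (w j * w j) * M i j ^ 2 := by ring
      _ = _ := by rw [hww, hww]
  have hXpos : X.PosSemidef := by
    have hD : (diagonal w * M * diagonal w).PosSemidef := by
      have := hM.mul_mul_conjTranspose_same (diagonal w)
      rwa [diagonal_conjTranspose, star_trivial] at this
    exact (hD.hadamard hD).smul (by positivity)
  have hSX := hsdp X hXpos fun i => by
    rw [hXapp, inv_mul_le_iff₀ (by positivity), mul_one]
    simp only [hw]
    split_ifs with h
    · simp; positivity
    · have := hM.diag_nonneg (i := i)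
      have h' : M i i ≤ t := not_lt.1 h
      simp only [one_mul]; gcongr
  have hsumX : ∑ i, ∑ j, B i j * X i j
      = (t ^ 2)⁻¹ * ∑ i, ∑ j, B i j * (w i * w j * M i j ^ 2) := by
    simp_rw [hXapp, mul_sum]
    refine sum_congr rfl fun i _ => sum_congr rfl fun j _ => by ring
  rw [hsumX, inv_mul_le_iff₀ (by positivity)] at hSX
  have hTi : ∑ i ∈ T, ∑ j, M i j ^ 2 ≤ T.card * n := by
    rw [← nsmul_eq_mul]; exact sum_le_card_nsmul _ _ _ fun i _ => hMrow i
  have hsymm : ∀ i j, M i j = M j i := fun i j => by rw [← hM.1.apply i j]; simp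
  have hFX : F ≤ ∑ i, ∑ j, B i j * (w i * w j * M i j ^ 2) + 2 * (T.card * n) := by
    have hpt : ∀ i j, B i j * M i j ^ 2 ≤ B i j * (w i * w j * M i j ^ 2)
        + (1 - w i) * M i j ^ 2 + (1 - w j) * M j i ^ 2 := by
      intro i j
      have h1 : B i j * M i j ^ 2 ≤ M i j ^ 2 :=
        mul_le_of_le_one_left (sq_nonneg _) ((le_abs_self _).trans (habs i j))
      have h2 := sq_nonneg (M i j)
      rw [hsymm j i]
      simp only [hw]
      split_ifs <;> simp <;> linarith
    have hTs : ∑ i, ∑ j, (1 - w i) * M i j ^ 2 = ∑ i ∈ T, ∑ j, M i j ^ 2 := by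
      rw [hT, sum_filter]
      refine sum_congr rfl fun i _ => ?_
      rw [← mul_sum]; simp only [hw]; split_ifs <;> simp
    calc F ≤ ∑ i, ∑ j, (B i j * (w i * w j * M i j ^ 2)
        + (1 - w i) * M i j ^ 2 + (1 - w j) * M j i ^ 2) :=
          sum_le_sum fun i _ => sum_le_sum fun j _ => hpt i j
      _ = ∑ i, ∑ j, B i j * (w i * w j * M i j ^ 2) + ∑ i, ∑ j, (1 - w i) * M i j ^ 2
          + ∑ i, ∑ j, (1 - w i) * M i j ^ 2 := by
        simp only [sum_add_distrib]
        congr 1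
        exact sum_comm
      _ ≤ _ := by rw [hTs]; linarith
  have hfin : ε ^ 2 / 8 * n ^ 2 ≤ t ^ 2 * S := by nlinarith
  have ht2 : t ^ 2 * S = 256 * S ^ 3 / (ε ^ 4 * n ^ 2) := by
    rw [ht]; field_simp; ring
  rw [ht2, le_div_iff₀ (by positivity)] at hfin
  linarith

/-- A two-valued symmetric matrix with zero row sums has large semidefinite value: if its pairing
with every positive semidefinite matrix of diagonal at most one is at most `S`, then
`S ^ 3` is of order at least `card V ^ 4`. -/
theorem pow_four_le_of_semidefinite_bound [DecidableEq V] {B : Matrix V V ℝ} {q ε S : ℝ} (hB : B.IsHermitian)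
    (hrow : ∀ i, ∑ j, B i j = 0) (habs : ∀ i j, |B i j| ≤ 1)
    (hsq : ∀ i j, B i j ^ 2 = q * (1 - q) + (2 * q - 1) * B i j)
    (hε : 0 < ε) (hq : 1 / 2 + ε ≤ q) (hq' : q ≤ 1 - ε) (hn : 1 ≤ Fintype.card V)
    (htr : 0 ≤ B.trace) (hS : 0 < S)
    (hsdp : ∀ X : Matrix V V ℝ, X.PosSemidef → (∀ i, X i i ≤ 1) →
      ∑ i, ∑ j, B i j * X i j ≤ S) :
    ε ^ 9 / 2048 * (Fintype.card V : ℝ) ^ 4 ≤ S ^ 3 := by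
  obtain ⟨E, hE, hEE, hEB, hP, hM, hE1⟩ := exists_spectral_projection hB
  set P := E * B with hPdef
  set M := P - B with hMdef
  set n : ℝ := (Fintype.card V : ℝ) with hndef
  have hn1 : 1 ≤ n := by rw [hndef]; exact_mod_cast hn
  have hn0 : 0 < n := by linarith
  have hBP : B = P - M := by rw [hMdef]; abel
  have hEP : E * P = P := by rw [hPdef, ← Matrix.mul_assoc, hEE]
  have hPP : P * P = P * B := by
    calc P * P = E * (B * E) * B := by simp only [hPdef, Matrix.mul_assoc]
      _ = P * B := by rw [← hEB, hEP]
  have hPP' : P * P = B * P := by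
    calc P * P = E * B * (E * B) := rfl
      _ = B * E * (E * B) := congrArg (· * (E * B)) hEB
      _ = B * (E * E * B) := by simp only [Matrix.mul_assoc]
      _ = B * P := by rw [hEE]
  have hBB : B * B = P * P + M * M := by
    have : M * M = B * B - P * P := by
      rw [hMdef, Matrix.sub_mul, Matrix.mul_sub, Matrix.mul_sub, ← hPP, ← hPP']; abel
    rw [this]; abel
  -- Frobenius norms by rows
  have hrowsq : ∀ i, ∑ j, B i j ^ 2 = ∑ j, P i j ^ 2 + ∑ j, M i j ^ 2 := by
    intro i
    rw [← sq_apply_diag hB, ← sq_apply_diag hP.1, ← sq_apply_diag hM.1, hBB]; rfl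
  have hrown : ∀ i, ∑ j, B i j ^ 2 ≤ n := by
    intro i
    calc ∑ j, B i j ^ 2 ≤ ∑ j : V, (1 : ℝ) :=
          sum_le_sum fun j _ => (sq_le_one_iff_abs_le_one _).2 (habs i j)
      _ = n := by simp [hndef]
  have hProw : ∀ i, ∑ j, P i j ^ 2 ≤ n := fun i => by
    have := hrown i; rw [hrowsq] at this
    have : 0 ≤ ∑ j, M i j ^ 2 := sum_nonneg fun j _ => sq_nonneg _
    linarith
  have hMrow : ∀ i, ∑ j, M i j ^ 2 ≤ n := fun i => by
    have := hrown i; rw [hrowsq] at this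
    have : 0 ≤ ∑ j, P i j ^ 2 := sum_nonneg fun j _ => sq_nonneg _
    linarith
  set p2 := ∑ i, ∑ j, P i j ^ 2 with hp2
  set m2 := ∑ i, ∑ j, M i j ^ 2 with hm2
  have hp2nn : 0 ≤ p2 := sum_nonneg fun i _ => sum_nonneg fun j _ => sq_nonneg _
  have hm2nn : 0 ≤ m2 := sum_nonneg fun i _ => sum_nonneg fun j _ => sq_nonneg _
  have hfro : p2 + m2 = q * (1 - q) * n ^ 2 := by
    rw [hp2, hm2, ← sum_add_distrib]
    simp_rw [← hrowsq, hsq, sum_add_distrib, ← mul_sum, hrow]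
    simp [hndef]; ring
  -- the trace of the positive part
  have htrP : P.trace ≤ S := by
    have h := hsdp E hE fun i => by
      have := hE1.diag_nonneg (i := i); simp at this; exact this
    rwa [sum_mul_eq_trace _ _ hE.1, ← hEB] at h
  have htrM : M.trace ≤ S := by rw [hMdef, trace_sub]; linarith
  have hp2tr : (P * P).trace = p2 := by
    simp only [trace, Matrix.diag, sq_apply_diag hP.1, hp2]
  -- The test matrix is `P² / n`; its diagonal is at most one by `hProw`.
  have htrP3 : (P * P * P).trace ≤ n * S := by
    have hX : (n⁻¹ • (P * P)).PosSemidef := by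
      refine PosSemidef.smul ?_ (by positivity)
      have := posSemidef_conjTranspose_mul_self P
      rwa [hP.1.eq] at this
    have h := hsdp _ hX fun i => by
      rw [Matrix.smul_apply, sq_apply_diag hP.1, smul_eq_mul, inv_mul_le_iff₀ hn0, mul_one]
      exact hProw i
    rw [sum_mul_eq_trace _ _ hX.1, Matrix.mul_smul, trace_smul, smul_eq_mul,
      inv_mul_le_iff₀ hn0, ← Matrix.mul_assoc, ← hPP'] at h
    exact h
  -- The trace form of `λ (λ - √n)² ≥ 0` on the eigenvalues of `P` interpolates `tr P²` between `tr
  -- P` and `tr P³`.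
  have hp2S : p2 ^ 2 ≤ n * S ^ 2 := by
    have hX : 0 ≤ ((P - √n • 1) * P * (P - √n • 1)).trace := by
      have h : (P - √n • (1 : Matrix V V ℝ)).IsHermitian := by
        refine hP.1.sub ?_
        simp [IsHermitian]
      have := (hP.conjTranspose_mul_mul_same (P - √n • (1 : Matrix V V ℝ))).trace_nonneg
      rwa [h.eq] at this
    have hexp : ((P - √n • 1) * P * (P - √n • 1)).trace
        = (P * P * P).trace - 2 * √n * p2 + n * P.trace := by
      have : (P - √n • 1) * P * (P - √n • 1)
          = P * P * P - (2 * √n) • (P * P) + (√n * √n) • P := by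
        simp only [Matrix.sub_mul, Matrix.mul_sub, Matrix.smul_mul, Matrix.mul_smul,
          Matrix.one_mul, Matrix.mul_one]
        module
      rw [this, trace_add, trace_sub, trace_smul, trace_smul, hp2tr,
        Real.mul_self_sqrt hn0.le]; rfl
    have hs : 0 < √n := Real.sqrt_pos.2 hn0
    have hss : √n * √n = n := Real.mul_self_sqrt hn0.le
    have h1 : √n * p2 ≤ √n * (√n * S) := by
      have := mul_le_mul_of_nonneg_left htrP hn0.le
      rw [← mul_assoc, hss]
      linarith
    have h2 : p2 ≤ √n * S := le_of_mul_le_mul_left h1 hs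
    calc p2 ^ 2 ≤ (√n * S) ^ 2 := by gcongr
      _ = n * S ^ 2 := by rw [mul_pow, sq √n, hss]
  -- the pairing of `B` with the Hadamard square of the negative part
  have hMsum : ∑ i, ∑ j, M i j = 0 := by
    have hMB : M = (E - 1) * B := by rw [hMdef, Matrix.sub_mul, Matrix.one_mul]
    have : ∀ i, ∑ j, M i j = 0 := fun i => by
      simp_rw [hMB, mul_apply]
      rw [sum_comm]
      simp_rw [← mul_sum, hrow]; simp
    simp [this]
  have hBM : ∑ i, ∑ j, B i j * M i j = -m2 := by
    rw [sum_mul_eq_trace _ _ hM.1]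
    have h0 : B * M = -(M * M) := by
      have h3 : P * M = 0 := by rw [hMdef, Matrix.mul_sub, hPP, sub_self]
      conv_lhs => rw [hBP, Matrix.sub_mul, h3, zero_sub]
    rw [h0, trace_neg]
    simp only [trace, Matrix.diag, sq_apply_diag hM.1, hm2]
  set F := ∑ i, ∑ j, B i j * M i j ^ 2 with hF
  -- Replace one factor `M` by `P - B`, then linearise `B i j ^ 2` with `hsq`; the constant term
  -- dies because `M` has entry sum zero.
  have hFeq : F = ∑ i, ∑ j, B i j * P i j * M i j + (2 * q - 1) * m2 := by
    have h1 : F = ∑ i, ∑ j, B i j * P i j * M i j - ∑ i, ∑ j, B i j ^ 2 * M i j := by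
      rw [hF, ← sum_sub_distrib]
      refine sum_congr rfl fun i _ => ?_
      rw [← sum_sub_distrib]
      refine sum_congr rfl fun j _ => ?_
      have : M i j = P i j - B i j := rfl
      rw [this]; ring
    have h2 : ∑ i, ∑ j, B i j ^ 2 * M i j = -(2 * q - 1) * m2 := by
      have : ∀ i j, B i j ^ 2 * M i j
          = q * (1 - q) * M i j + (2 * q - 1) * (B i j * M i j) := fun i j => by
        rw [hsq]; ring
      simp_rw [this, sum_add_distrib, ← mul_sum]
      rw [hMsum, hBM]; ring
    rw [h1, h2]; ring
  -- With these weights, `p2 < ε² m2` makes the cross term at least `-ε m2`, half of what `2q - 1 ≥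
  -- 2ε` supplies.
  have hcross : -(ε⁻¹ * p2 / 2 + ε * m2 / 2) ≤ ∑ i, ∑ j, B i j * P i j * M i j := by
    have : ∀ i j, -(ε⁻¹ * P i j ^ 2 / 2 + ε * M i j ^ 2 / 2) ≤ B i j * P i j * M i j := by
      intro i j
      have h1 : |B i j * P i j * M i j| ≤ |P i j| * |M i j| := by
        rw [abs_mul, abs_mul, mul_assoc]
        exact mul_le_of_le_one_left (by positivity) (habs i j)
      have h2 : |P i j| * |M i j| ≤ ε⁻¹ * P i j ^ 2 / 2 + ε * M i j ^ 2 / 2 := by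
        have h3 : 0 ≤ ε⁻¹ * (|P i j| - ε * |M i j|) ^ 2 := by positivity
        have h4 : ε⁻¹ * (|P i j| - ε * |M i j|) ^ 2
            = ε⁻¹ * P i j ^ 2 - 2 * (|P i j| * |M i j|) + ε * M i j ^ 2 := by
          rw [← sq_abs (P i j), ← sq_abs (M i j)]; field_simp; ring
        linarith
      have := neg_abs_le (B i j * P i j * M i j)
      linarith
    calc -(ε⁻¹ * p2 / 2 + ε * m2 / 2)
        = ∑ i, ∑ j, -(ε⁻¹ * P i j ^ 2 / 2 + ε * M i j ^ 2 / 2) := by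
          simp only [sum_neg_distrib, sum_add_distrib, ← sum_div, ← mul_sum, hp2, hm2]
      _ ≤ _ := sum_le_sum fun i _ => sum_le_sum fun j _ => this i j
  have hε1 : ε ≤ 1 / 4 := by linarith
  have ha : ε / 2 ≤ q * (1 - q) := by nlinarith
  have hpm : ε / 2 * n ^ 2 ≤ p2 + m2 := by rw [hfro]; gcongr
  rcases le_or_gt (ε ^ 2 * m2) p2 with hcase | hcase
  · have h1 : ε ^ 3 / 4 * n ^ 2 ≤ p2 := by
      have h2 : ε ^ 2 * (ε / 2 * n ^ 2) ≤ ε ^ 2 * (p2 + m2) := by gcongr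
      have h3 : ε ^ 2 * p2 ≤ 1 * p2 := by
        gcongr; nlinarith
      linarith
    have h2 : (ε ^ 3 / 4 * n ^ 2) ^ 2 ≤ n * S ^ 2 := le_trans (by gcongr) hp2S
    have h3 : ε ^ 6 / 16 * n ^ 3 ≤ S ^ 2 := by
      refine le_of_mul_le_mul_left ?_ hn0
      calc n * (ε ^ 6 / 16 * n ^ 3) = (ε ^ 3 / 4 * n ^ 2) ^ 2 := by ring
        _ ≤ _ := h2
    refine (sq_le_sq₀ (by positivity) (by positivity)).1 ?_
    calc (ε ^ 9 / 2048 * n ^ 4) ^ 2 = ε ^ 18 / 2048 ^ 2 * (n ^ 8 * 1) := by ring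
      _ ≤ ε ^ 18 / 16 ^ 3 * (n ^ 8 * n) := by gcongr; norm_num
      _ = (ε ^ 6 / 16 * n ^ 3) ^ 3 := by ring
      _ ≤ (S ^ 2) ^ 3 := by gcongr
      _ = (S ^ 3) ^ 2 := by ring
  · have hm2n : ε / 4 * n ^ 2 ≤ m2 := by
      have : ε ^ 2 * m2 ≤ 1 * m2 := by
        gcongr; exact pow_le_one₀ hε.le (by linarith)
      linarith
    have hFlow : ε ^ 2 / 4 * n ^ 2 ≤ F := by
      have h1 : ε⁻¹ * p2 ≤ ε * m2 := by
        rw [inv_mul_le_iff₀ hε]; linarith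
      have h2 : 2 * ε * m2 ≤ (2 * q - 1) * m2 := by gcongr; linarith
      have h3 : ε * (ε / 4 * n ^ 2) ≤ ε * m2 := by gcongr
      linarith
    have h6 := pow_three_ge_of_hadamard_sq hn0 hS hε hM habs hMrow htrM hFlow hsdp
    refine le_trans ?_ h6
    gcongr ?_ / _ * _
    exact pow_le_pow_of_le_one hε.le (by linarith) (by norm_num)

end Spectral

/-! ### Random sign rounding -/

section Rounding

variable {V : Type*} [Fintype V] [DecidableEq V]

/-- The sign attached to a truth value. -/
def sgn (b : Bool) : ℝ := if b then 1 else -1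

theorem sgn_mul_self (b : Bool) : sgn b * sgn b = 1 := by cases b <;> simp [sgn]

theorem sgn_not (b : Bool) : sgn (!b) = -sgn b := by cases b <;> simp [sgn]

theorem sum_sgn_mul_sgn (k l : V) :
    ∑ s : V → Bool, sgn (s k) * sgn (s l) = if k = l then 2 ^ Fintype.card V else 0 := by
  split_ifs with h
  · subst h; simp [sgn_mul_self]
  · have hinv : Function.Involutive fun s : V → Bool => Function.update s k (!s k) := by
      intro s; simp
    have := Equiv.sum_comp hinv.toPerm fun s : V → Bool => sgn (s k) * sgn (s l)
    have h2 : ∀ s : V → Bool, sgn (Function.update s k (!s k) k) * sgn (Function.update s k (!s k) l)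
        = -(sgn (s k) * sgn (s l)) := by
      intro s
      simp [Function.update_of_ne (Ne.symm h), sgn_not]
    simp only [Function.Involutive.coe_toPerm, h2, sum_neg_distrib] at this
    linarith

/-- The signed sum of the rows of `W` along a sign vector. -/
noncomputable def signedSum (W : Matrix V V ℝ) (s : V → Bool) (i : V) : ℝ := ∑ k, sgn (s k) * W k i

theorem sum_signedSum_mul (W : Matrix V V ℝ) (i j : V) :
    ∑ s, signedSum W s i * signedSum W s j = 2 ^ Fintype.card V * (Wᵀ * W) i j := by
  have : ∀ s : V → Bool, signedSum W s i * signedSum W s j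
      = ∑ k, ∑ l, sgn (s k) * sgn (s l) * (W k i * W l j) := by
    intro s
    rw [signedSum, signedSum, sum_mul_sum]
    exact sum_congr rfl fun k _ => sum_congr rfl fun l _ => by ring
  simp_rw [this]
  rw [sum_comm]
  have h2 : ∀ k, ∑ s : V → Bool, ∑ l, sgn (s k) * sgn (s l) * (W k i * W l j)
      = 2 ^ Fintype.card V * (W k i * W k j) := by
    intro k
    rw [sum_comm]
    simp_rw [← sum_mul, sum_sgn_mul_sgn]
    simp
  simp_rw [h2, ← mul_sum, mul_apply, transpose_apply]

/-- The sum over sign vectors factors over coordinates, and each factor is controlled by `cosh x ≤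
exp (x² / 2)`. -/
theorem sum_exp_signedSum_le (W : Matrix V V ℝ) (i : V) {σ : ℝ} (hW : ∑ k, W k i ^ 2 ≤ σ)
    (r : ℝ) :
    ∑ s, Real.exp (r * signedSum W s i) ≤ 2 ^ Fintype.card V * Real.exp (r ^ 2 * σ / 2) := by
  have h1 : ∀ s : V → Bool, Real.exp (r * signedSum W s i)
      = ∏ k, Real.exp (r * (sgn (s k) * W k i)) := by
    intro s; rw [signedSum, mul_sum, Real.exp_sum]
  simp_rw [h1]
  have h2 := Fintype.prod_sum fun (k : V) (b : Bool) => Real.exp (r * (sgn b * W k i))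
  rw [← h2]
  calc ∏ k, ∑ b, Real.exp (r * (sgn b * W k i))
      ≤ ∏ k, 2 * Real.exp ((r * W k i) ^ 2 / 2) := by
        refine prod_le_prod (fun k _ => sum_nonneg fun b _ => (Real.exp_pos _).le) fun k _ => ?_
        have h3 := Real.cosh_le_exp_half_sq (r * W k i)
        rw [Real.cosh_eq] at h3
        simp only [Fintype.sum_bool, sgn, if_true, Bool.false_eq_true, if_false, one_mul,
          neg_mul, mul_neg]
        linarith
    _ = 2 ^ Fintype.card V * Real.exp (r ^ 2 * (∑ k, W k i ^ 2) / 2) := by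
        rw [prod_mul_distrib, ← Real.exp_sum]
        simp only [prod_const, card_univ]
        congr 2
        rw [mul_sum, sum_div]
        exact sum_congr rfl fun k _ => by ring
    _ ≤ _ := by gcongr

theorem card_lt_abs_signedSum_le (W : Matrix V V ℝ) (i : V) (hW : ∑ k, W k i ^ 2 ≤ 4)
    {T : ℝ} (hT : 0 ≤ T) :
    ((univ.filter fun s => T < |signedSum W s i|).card : ℝ)
      ≤ 2 ^ Fintype.card V * (2 * Real.exp (-T ^ 2 / 8)) := by
  -- Chernoff bound with exponent `r = T / 4`, the minimiser of `-r T + 2 r²`.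
  have hb : ∀ s ∈ univ.filter fun s => T < |signedSum W s i|, (1 : ℝ)
      ≤ Real.exp (-T ^ 2 / 4) * (Real.exp (T / 4 * signedSum W s i)
        + Real.exp (-(T / 4) * signedSum W s i)) := by
    intro s hs
    have hs' : T < |signedSum W s i| := by simpa using hs
    rw [mul_add, ← Real.exp_add, ← Real.exp_add]
    rcases lt_abs.1 hs' with h | h
    · have : 1 ≤ Real.exp (-T ^ 2 / 4 + T / 4 * signedSum W s i) :=
        Real.one_le_exp (by nlinarith)
      have := Real.exp_pos (-T ^ 2 / 4 + -(T / 4) * signedSum W s i)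
      linarith
    · have : 1 ≤ Real.exp (-T ^ 2 / 4 + -(T / 4) * signedSum W s i) :=
        Real.one_le_exp (by nlinarith)
      have := Real.exp_pos (-T ^ 2 / 4 + T / 4 * signedSum W s i)
      linarith
  calc ((univ.filter fun s => T < |signedSum W s i|).card : ℝ)
      = ∑ s ∈ univ.filter fun s => T < |signedSum W s i|, (1 : ℝ) := by simp
    _ ≤ _ := sum_le_sum hb
    _ ≤ ∑ s, Real.exp (-T ^ 2 / 4) * (Real.exp (T / 4 * signedSum W s i)
        + Real.exp (-(T / 4) * signedSum W s i)) :=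
        sum_le_sum_of_subset_of_nonneg (subset_univ _) fun s _ _ => by positivity
    _ = Real.exp (-T ^ 2 / 4) * (∑ s, Real.exp (T / 4 * signedSum W s i)
        + ∑ s, Real.exp (-(T / 4) * signedSum W s i)) := by
        rw [← mul_sum, sum_add_distrib]
    _ ≤ Real.exp (-T ^ 2 / 4) * (2 ^ Fintype.card V * Real.exp ((T / 4) ^ 2 * 4 / 2)
        + 2 ^ Fintype.card V * Real.exp ((-(T / 4)) ^ 2 * 4 / 2)) := by
        gcongr
        · exact sum_exp_signedSum_le W i hW _
        · exact sum_exp_signedSum_le W i hW _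
    _ = 2 ^ Fintype.card V * (2 * (Real.exp (-T ^ 2 / 4) * Real.exp (T ^ 2 / 8))) := by
        ring_nf
    _ = _ := by rw [← Real.exp_add]; ring_nf

/-- Rounding a Gram matrix to the cube: a quadratic form bounded by `K` on the cube
is bounded on Gram matrices by `T ^ 2 * K`, up to an error that decays in the truncation `T`. -/
theorem sum_mul_gram_le {C W : Matrix V V ℝ} {K T : ℝ} (hC : ∀ i j, |C i j| ≤ 1)
    (hK : ∀ x : V → ℝ, (∀ i, |x i| ≤ 1) → ∑ i, ∑ j, C i j * (x i * x j) ≤ K) (hT : 0 < T)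
    (hW : ∀ i, ∑ k, W k i ^ 2 ≤ 4) :
    ∑ i, ∑ j, C i j * (Wᵀ * W) i j
      ≤ T ^ 2 * K + 8 * (Fintype.card V : ℝ) ^ 4 * Real.exp (-T ^ 2 / 8) := by
  set n : ℝ := (Fintype.card V : ℝ) with hn
  set N : ℝ := 2 ^ Fintype.card V with hN
  have hN0 : 0 < N := by positivity
  have hK0 : 0 ≤ K := by simpa using hK 0 (by simp)
  set Q : (V → Bool) → ℝ :=
    fun s => ∑ i, ∑ j, C i j * (signedSum W s i * signedSum W s j) with hQ
  set bad : Finset (V → Bool) := univ.filter fun s => ∃ i, T < |signedSum W s i| with hbad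
  have hQsum : ∑ s, Q s = N * ∑ i, ∑ j, C i j * (Wᵀ * W) i j := by
    simp only [hQ]
    rw [sum_comm, mul_sum]
    refine sum_congr rfl fun i _ => ?_
    rw [sum_comm, mul_sum]
    refine sum_congr rfl fun j _ => ?_
    rw [← mul_sum, sum_signedSum_mul]; ring
  have hgood : ∀ s, s ∉ bad → Q s ≤ T ^ 2 * K := by
    intro s hs
    have hs' : ∀ i, |signedSum W s i| ≤ T := by simpa [hbad] using hs
    have h := hK (fun i => signedSum W s i / T) fun i => by
      rw [abs_div, abs_of_pos hT, div_le_one hT]; exact hs' i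
    have h2 : Q s = T ^ 2 * ∑ i, ∑ j, C i j * (signedSum W s i / T * (signedSum W s j / T)) := by
      simp only [hQ, mul_sum]
      refine sum_congr rfl fun i _ => sum_congr rfl fun j _ => ?_
      field_simp
    rw [h2]; gcongr
  have hsize : ∀ s i, signedSum W s i ^ 2 ≤ 4 * n := by
    intro s i
    have h := sum_mul_sq_le_sq_mul_sq univ (fun k => sgn (s k)) fun k => W k i
    have h1 : ∑ k, sgn (s k) ^ 2 = n := by simp [sq, sgn_mul_self, hn]
    rw [h1] at h
    have hn0 : 0 ≤ n := by positivity
    calc signedSum W s i ^ 2 ≤ n * ∑ k, W k i ^ 2 := h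
      _ ≤ n * 4 := by gcongr; exact hW i
      _ = 4 * n := by ring
  have hall : ∀ s, Q s ≤ 4 * n ^ 3 := by
    intro s
    calc Q s ≤ ∑ i : V, ∑ j : V, 4 * n := by
          refine sum_le_sum fun i _ => sum_le_sum fun j _ => ?_
          refine (le_abs_self _).trans ?_
          rw [abs_mul]
          refine (mul_le_of_le_one_left (abs_nonneg _) (hC i j)).trans ?_
          rw [abs_mul]
          have h1 := hsize s i
          have h2 := hsize s j
          rw [← sq_abs] at h1 h2
          nlinarith [sq_nonneg (|signedSum W s i| - |signedSum W s j|)]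
      _ = 4 * n ^ 3 := by simp [hn]; ring
  have hbadcard : (bad.card : ℝ) ≤ n * (N * (2 * Real.exp (-T ^ 2 / 8))) := by
    have hsub : bad ⊆ univ.biUnion fun i => univ.filter fun s => T < |signedSum W s i| := by
      intro s hs
      simpa [hbad] using hs
    calc (bad.card : ℝ)
        ≤ ((∑ i, (univ.filter fun s => T < |signedSum W s i|).card : ℕ) : ℝ) := by
          exact_mod_cast (card_le_card hsub).trans card_biUnion_le
      _ ≤ ∑ i : V, N * (2 * Real.exp (-T ^ 2 / 8)) := by
          push_cast
          exact sum_le_sum fun i _ => card_lt_abs_signedSum_le W i (hW i) hT.le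
      _ = _ := by simp [hn]
  have hmain : ∑ s, Q s ≤ N * (T ^ 2 * K) + bad.card * (4 * n ^ 3) := by
    have h1 : ∀ s, Q s ≤ T ^ 2 * K + if s ∈ bad then 4 * n ^ 3 else 0 := by
      intro s
      split_ifs with h
      · have := hall s
        have : 0 ≤ T ^ 2 * K := by positivity
        linarith
      · simpa using hgood s h
    calc ∑ s, Q s ≤ _ := sum_le_sum fun s _ => h1 s
      _ = _ := by
        rw [sum_add_distrib, ← sum_filter, filter_univ_mem]
        simp [hN]
  rw [hQsum] at hmain
  have h4 : (bad.card : ℝ) * (4 * n ^ 3)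
      ≤ n * (N * (2 * Real.exp (-T ^ 2 / 8))) * (4 * n ^ 3) := by gcongr
  refine le_of_mul_le_mul_left ?_ hN0
  calc _ ≤ _ := hmain
    _ ≤ N * (T ^ 2 * K) + n * (N * (2 * Real.exp (-T ^ 2 / 8))) * (4 * n ^ 3) := by linarith
    _ = _ := by ring

/-- A quadratic form with zero diagonal attains its maximum over the cube at a vertex. -/
theorem exists_vertex_ge {C : Matrix V V ℝ} (hdiag : ∀ i, C i i = 0) {x : V → ℝ}
    (hx : ∀ i, |x i| ≤ 1) :
    ∃ y : V → ℝ, (∀ i, y i = 1 ∨ y i = -1) ∧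
      ∑ i, ∑ j, C i j * (x i * x j) ≤ ∑ i, ∑ j, C i j * (y i * y j) := by
  set f : (V → ℝ) → ℝ := fun x => ∑ i, ∑ j, C i j * (x i * x j) with hf
  -- The zero diagonal excludes a `t²` term, so each coordinate can be pushed to an endpoint without
  -- decreasing `f`.
  have haff : ∀ (x : V → ℝ) (k : V), ∃ a b : ℝ, ∀ t, f (Function.update x k t) = a + b * t := by
    intro x k
    set z := Function.update x k 0 with hz
    refine ⟨f z, ∑ j, C k j * z j + ∑ i, C i k * z i, fun t => ?_⟩
    have hu : ∀ i, Function.update x k t i = z i + if i = k then t else 0 := by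
      intro i
      by_cases h : i = k
      · subst h; simp [hz]
      · simp [hz, h]
    have hexp : ∀ i j, C i j * (Function.update x k t i * Function.update x k t j)
        = C i j * (z i * z j) + (if i = k then C i j * z j * t else 0)
          + (if j = k then C i j * z i * t else 0) := by
      intro i j
      rw [hu, hu]
      by_cases h : i = k
      · by_cases h' : j = k
        · subst h; subst h'; simp [hdiag]
        · simp [h, h']; ring
      · by_cases h' : j = k
        · simp [h, h']; ring
        · simp [h, h']
    simp only [hf, hexp, sum_add_distrib]
    have h1 : ∑ i, ∑ j, (if i = k then C i j * z j * t else 0) = ∑ j, C k j * z j * t := by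
      rw [sum_comm]; simp
    have h2 : ∑ i, ∑ j, (if j = k then C i j * z i * t else 0) = ∑ i, C i k * z i * t := by simp
    rw [h1, h2, ← sum_mul, ← sum_mul]; ring
  have hstep : ∀ (s : Finset V), ∃ y : V → ℝ, (∀ i, |y i| ≤ 1) ∧
      (∀ i ∈ s, y i = 1 ∨ y i = -1) ∧ f x ≤ f y := by
    intro s
    induction s using Finset.induction_on with
    | empty => exact ⟨x, hx, by simp, le_rfl⟩
    | insert k s hk ih =>
      obtain ⟨y, hy1, hy2, hy3⟩ := ih
      obtain ⟨a, b, hab⟩ := haff y k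
      have hyk : f y = a + b * y k := by
        have := hab (y k); rwa [Function.update_eq_self] at this
      obtain ⟨t, ht, hbt⟩ : ∃ t : ℝ, (t = 1 ∨ t = -1) ∧ b * y k ≤ b * t := by
        have := abs_le.1 (hy1 k)
        rcases le_total 0 b with hb | hb
        · exact ⟨1, Or.inl rfl, by nlinarith⟩
        · exact ⟨-1, Or.inr rfl, by nlinarith⟩
      refine ⟨Function.update y k t, fun i => ?_, fun i hi => ?_, ?_⟩
      · by_cases h : i = k
        · subst h; rcases ht with rfl | rfl <;> simp
        · simpa [h] using hy1 i
      · by_cases h : i = k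
        · subst h; simpa using ht
        · simpa [h] using hy2 i ((mem_insert.1 hi).resolve_left h)
      · rw [hab]; linarith
  obtain ⟨y, -, hy, hxy⟩ := hstep univ
  exact ⟨y, fun i => hy i (mem_univ i), hxy⟩

end Rounding

/-! ### From the semidefinite value to cuts -/

section Graph

variable {V : Type*} [Fintype V] [DecidableEq V]

open scoped MatrixOrder Matrix.Norms.L2Operator in
theorem exists_eq_conjTranspose_mul_self {X : Matrix V V ℝ} (hX : X.PosSemidef) :
    ∃ R : Matrix V V ℝ, X = Rᴴ * R :=
  CStarAlgebra.nonneg_iff_eq_star_mul_self.mp hX.nonneg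

variable (G : SimpleGraph V) [DecidableRel G.Adj]

/-- The indicator of a cut pair is `(1 + x i) (1 - x j) / 4`; summed against the adjacency matrix,
its linear terms cancel by symmetry. -/
theorem neg_adjMatrix_form_le_surplus_of_sign {x : V → ℝ} (hx : ∀ i, x i = 1 ∨ x i = -1) :
    ∑ i, ∑ j, -G.adjMatrix ℝ i j * (x i * x j) ≤ 4 * G.surplus := by
  set S : Finset V := univ.filter fun i => x i = 1 with hS
  have hle : (G.cutSize S : ℝ) - (G.edgeFinset.card : ℝ) / 2 ≤ G.surplus :=
    le_sup' (fun S : Finset V => (G.cutSize S : ℝ) - (G.edgeFinset.card : ℝ) / 2) (mem_univ S)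
  have hedge : ∑ i, ∑ j, G.adjMatrix ℝ i j = 2 * (G.edgeFinset.card : ℝ) := by
    have h := G.sum_degrees_eq_twice_card_edges
    have h2 : ∀ i, ∑ j, G.adjMatrix ℝ i j = (G.degree i : ℝ) := by
      intro i; simp [SimpleGraph.adjMatrix_apply, ← SimpleGraph.card_neighborFinset_eq_degree,
        SimpleGraph.neighborFinset_eq_filter]
    simp_rw [h2]
    exact_mod_cast h
  have hcut : (G.cutSize S : ℝ)
      = ∑ i, ∑ j, G.adjMatrix ℝ i j * ((1 + x i) * (1 - x j) / 4) := by
    rw [SimpleGraph.cutSize, SimpleGraph.interedges, Rel.interedges, card_filter, sum_product]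
    push_cast
    rw [← sum_subset (subset_univ S) fun i _ hi => by
      have h : x i = -1 := (hx i).resolve_left (by simpa [hS] using hi)
      simp [h]]
    refine sum_congr rfl fun i hi => ?_
    rw [← sum_subset (subset_univ Sᶜ) fun j _ hj => by
      have h : x j = 1 := by simpa [hS] using hj
      simp [h]]
    refine sum_congr rfl fun j hj => ?_
    have hi' : x i = 1 := by simpa [hS] using hi
    have hj' : x j = -1 := (hx j).resolve_left (by simpa [hS] using hj)
    rw [hi', hj', SimpleGraph.adjMatrix_apply]
    norm_num
  have hsymm : ∑ i, ∑ j, G.adjMatrix ℝ i j * x i = ∑ i, ∑ j, G.adjMatrix ℝ i j * x j := by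
    rw [sum_comm]
    simp [SimpleGraph.adjMatrix_apply, G.adj_comm]
  have hexp : ∀ i j, G.adjMatrix ℝ i j * ((1 + x i) * (1 - x j) / 4)
      = G.adjMatrix ℝ i j / 4 + G.adjMatrix ℝ i j * x i / 4 - G.adjMatrix ℝ i j * x j / 4
        + -G.adjMatrix ℝ i j * (x i * x j) / 4 := fun i j => by ring
  simp_rw [hexp, sum_add_distrib, sum_sub_distrib, sum_add_distrib, ← sum_div] at hcut
  rw [hedge, hsymm] at hcut
  linarith

theorem neg_adjMatrix_form_le_surplus {x : V → ℝ} (hx : ∀ i, |x i| ≤ 1) :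
    ∑ i, ∑ j, -G.adjMatrix ℝ i j * (x i * x j) ≤ 4 * G.surplus := by
  obtain ⟨y, hy, hxy⟩ := exists_vertex_ge (C := -G.adjMatrix ℝ) (by simp) hx
  exact hxy.trans (neg_adjMatrix_form_le_surplus_of_sign G hy)

/-- The semidefinite relaxation of the surplus of a regular graph exceeds the surplus by at most a
logarithmic factor, up to an additive constant. -/
theorem semidefinite_le_log_mul_surplus {d : ℕ} (hG : G.IsRegularOfDegree d)
    (hn : 2 ≤ Fintype.card V) {X : Matrix V V ℝ} (hX : X.PosSemidef) (hX1 : ∀ i, X i i ≤ 1) :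
    ∑ i, ∑ j, ((d : ℝ) / Fintype.card V - G.adjMatrix ℝ i j) * X i j
      ≤ 288 * (Real.log (Fintype.card V) * G.surplus) + 1 / 4 := by
  set n : ℝ := (Fintype.card V : ℝ) with hndef
  have hn2 : 2 ≤ n := by rw [hndef]; exact_mod_cast hn
  have hn0 : 0 < n := by linarith
  obtain ⟨R, hR⟩ := exists_eq_conjTranspose_mul_self hX
  have hRX : ∀ i j, X i j = ∑ k, R k i * R k j := by
    intro i j; rw [hR]; simp [mul_apply]
  have hRn : ∀ i, ∑ k, R k i ^ 2 ≤ 1 := by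
    intro i; have := hX1 i; rw [hRX] at this; simpa [sq] using this
  -- centre the columns of `R`
  set m : V → ℝ := fun k => (∑ i, R k i) / n with hm
  set W : Matrix V V ℝ := of fun k i => R k i - m k with hW
  have hmn : ∑ k, m k ^ 2 ≤ 1 := by
    have h1 : ∀ k, m k ^ 2 ≤ (∑ i, R k i ^ 2) / n := by
      intro k
      have h := sq_sum_le_card_mul_sum_sq (s := univ) (f := fun i => R k i)
      rw [card_univ, ← hndef] at h
      rw [hm, div_pow, div_le_div_iff₀ (by positivity) hn0]
      nlinarith
    calc ∑ k, m k ^ 2 ≤ ∑ k, (∑ i, R k i ^ 2) / n := sum_le_sum fun k _ => h1 k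
      _ = (∑ i, ∑ k, R k i ^ 2) / n := by rw [← sum_div, sum_comm]
      _ ≤ (∑ i : V, (1 : ℝ)) / n := by gcongr with i; exact hRn i
      _ = 1 := by simp [← hndef, hn0.ne']
  have hWn : ∀ i, ∑ k, W k i ^ 2 ≤ 4 := by
    intro i
    calc ∑ k, W k i ^ 2 ≤ ∑ k, (2 * R k i ^ 2 + 2 * m k ^ 2) := by
          refine sum_le_sum fun k _ => ?_
          simp only [hW, of_apply]
          nlinarith [sq_nonneg (R k i + m k)]
      _ = 2 * ∑ k, R k i ^ 2 + 2 * ∑ k, m k ^ 2 := by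
          rw [sum_add_distrib, ← mul_sum, ← mul_sum]
      _ ≤ 4 := by have := hRn i; linarith
  have hW0 : ∀ k, ∑ i, W k i = 0 := by
    intro k
    simp only [hW, of_apply, sum_sub_distrib, sum_const, card_univ, nsmul_eq_mul, ← hndef, hm]
    field_simp; ring
  have hrow : ∀ i, ∑ j, G.adjMatrix ℝ i j = d := by
    intro i
    rw [← hG i]
    simp [SimpleGraph.adjMatrix_apply, ← SimpleGraph.card_neighborFinset_eq_degree,
        SimpleGraph.neighborFinset_eq_filter]
  have hBrow : ∀ i, ∑ j, ((d : ℝ) / n - G.adjMatrix ℝ i j) = 0 := by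
    intro i
    rw [sum_sub_distrib, hrow]
    simp only [sum_const, card_univ, nsmul_eq_mul, ← hndef]
    field_simp; ring
  have hBsymm : ∀ i j, (d : ℝ) / n - G.adjMatrix ℝ i j = (d : ℝ) / n - G.adjMatrix ℝ j i := by
    intro i j; simp [SimpleGraph.adjMatrix_apply, G.adj_comm]
  have hBcol : ∀ j, ∑ i, ((d : ℝ) / n - G.adjMatrix ℝ i j) = 0 := by
    intro j
    rw [← hBrow j]; exact sum_congr rfl fun i _ => hBsymm i j
  -- centring does not change the pairing
  have hpair : ∑ i, ∑ j, ((d : ℝ) / n - G.adjMatrix ℝ i j) * X i j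
      = ∑ i, ∑ j, -G.adjMatrix ℝ i j * (Wᵀ * W) i j := by
    have hk : ∀ k, ∑ i, ∑ j, ((d : ℝ) / n - G.adjMatrix ℝ i j) * (R k i * R k j)
        = ∑ i, ∑ j, -G.adjMatrix ℝ i j * (W k i * W k j) := by
      intro k
      -- The `d / n` term vanishes on centred rows of `W`; the terms in `m k` vanish since `B` has
      -- zero row and column sums.
      have he : ∀ i j, ((d : ℝ) / n - G.adjMatrix ℝ i j) * (R k i * R k j)
          = -G.adjMatrix ℝ i j * (W k i * W k j) + d / n * W k i * W k j
            + ((d : ℝ) / n - G.adjMatrix ℝ i j) * (m k * R k i)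
            + ((d : ℝ) / n - G.adjMatrix ℝ i j) * (m k * W k j) := by
        intro i j; simp only [hW, of_apply]; ring
      simp_rw [he, sum_add_distrib, ← mul_sum, hW0, ← sum_mul, hBrow]
      have hz : ∑ i, ∑ j, ((d : ℝ) / n - G.adjMatrix ℝ i j) * (m k * W k j) = 0 := by
        rw [sum_comm]; simp_rw [← sum_mul, hBcol]; simp
      rw [hz]; simp
    calc _ = ∑ k, ∑ i, ∑ j, ((d : ℝ) / n - G.adjMatrix ℝ i j) * (R k i * R k j) := by
          simp_rw [hRX, mul_sum]
          rw [sum_comm]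
          conv_rhs => rw [sum_comm]
          rw [sum_comm]
          exact sum_congr rfl fun i _ => sum_comm
      _ = ∑ k, ∑ i, ∑ j, -G.adjMatrix ℝ i j * (W k i * W k j) := sum_congr rfl fun k _ => hk k
      _ = _ := by
          simp_rw [mul_apply, transpose_apply, mul_sum]
          rw [sum_comm]
          exact sum_congr rfl fun i _ => sum_comm
  have hlog : 0 < Real.log n := Real.log_pos (by linarith)
  -- The constant 72 makes `exp (-T² / 8) = n⁻⁹`, which beats the factor `8 n⁴`.
  set T := √(72 * Real.log n) with hT
  have hTT : T ^ 2 = 72 * Real.log n := Real.sq_sqrt (by positivity)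
  have h := sum_mul_gram_le (C := -G.adjMatrix ℝ) (W := W) (K := 4 * G.surplus) (T := T)
    (by intro i j; simp only [Matrix.neg_apply, SimpleGraph.adjMatrix_apply]
        split_ifs <;> simp)
    (fun x hx => neg_adjMatrix_form_le_surplus G hx) (Real.sqrt_pos.2 (by positivity)) hWn
  have herr : 8 * n ^ 4 * Real.exp (-T ^ 2 / 8) ≤ 1 / 4 := by
    have h1 : Real.exp (-T ^ 2 / 8) = (n ^ 9)⁻¹ := by
      rw [hTT, show -(72 * Real.log n) / 8 = -((9 : ℕ) * Real.log n) by push_cast; ring,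
        Real.exp_neg, Real.exp_nat_mul, Real.exp_log hn0]
    rw [h1, show 8 * n ^ 4 * (n ^ 9)⁻¹ = 8 / n ^ 5 by field_simp, div_le_iff₀ (by positivity)]
    have : (2 : ℝ) ^ 5 ≤ n ^ 5 := by gcongr
    linarith
  rw [hpair]
  refine h.trans ?_
  rw [← hndef]
  rw [hTT] at *
  linarith

end Graph

end SpectralSurplus

/-! ### Assembling the bound -/

theorem theorem1p3 (ε : ℝ) (hε : 0 < ε) :
    ∃ c : ℝ, 0 < c ∧
      ∀ (V : Type*) [Fintype V] [DecidableEq V] (G : SimpleGraph V) [DecidableRel G.Adj]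
        (n d : ℕ), Fintype.card V = n → G.IsRegularOfDegree d →
        (1 / 2 + ε) * (n : ℝ) ≤ (d : ℝ) → (d : ℝ) ≤ (1 - ε) * (n : ℝ) →
        c * (n : ℝ) ^ (5 / 4 : ℝ) / Real.log (n : ℝ) ≤ G.surplus := by
  -- `6144 = 16 * 384`: 384 comes from the choice of `S`, and `16 ^ 3 ≥ 2048` allows the cube root.
  refine ⟨ε ^ 3 / 6144, by positivity, ?_⟩
  intro V _ _ G _ n d hcard hG hd1 hd2
  subst hcard
  set n : ℝ := (Fintype.card V : ℝ) with hndef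
  rcases Nat.eq_zero_or_pos (Fintype.card V) with h0 | hpos
  · have h0' : n = 0 := by rw [hndef, h0]; simp
    have h := SpectralSurplus.neg_adjMatrix_form_le_surplus G (x := 0) (by simp)
    simp only [Pi.zero_apply, mul_zero, Finset.sum_const_zero] at h
    rw [h0', Real.zero_rpow (by norm_num)]
    simp; linarith
  have hn1 : 1 ≤ n := by rw [hndef]; exact_mod_cast hpos
  have hd0 : 0 < d := by
    have : (0 : ℝ) < d := by nlinarith
    exact_mod_cast this
  have hn2N : 2 ≤ Fintype.card V := by
    by_contra hlt
    have h1 : Fintype.card V = 1 := by omega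
    have h1' : n = 1 := by rw [hndef, h1]; simp
    have : (d : ℝ) < 1 := by rw [h1'] at hd2; linarith
    have : d < 1 := by exact_mod_cast this
    omega
  have hn2 : 2 ≤ n := by rw [hndef]; exact_mod_cast hn2N
  have hn0 : 0 < n := by linarith
  have hlog : 0 < Real.log n := Real.log_pos (by linarith)
  set q : ℝ := d / n with hq
  have hsdp := fun (X : Matrix V V ℝ) (hX : X.PosSemidef) hX1 =>
    SpectralSurplus.semidefinite_le_log_mul_surplus G hG hn2N hX hX1
  rw [← hndef, ← hq] at hsdp
  set B : Matrix V V ℝ := Matrix.of fun i j => q - G.adjMatrix ℝ i j with hB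
  have hd1' : (1 : ℝ) ≤ d := by exact_mod_cast hd0
  have htr : B.trace = d := by
    simp only [Matrix.trace, Matrix.diag, hB, Matrix.of_apply, SimpleGraph.adjMatrix_apply,
      SimpleGraph.irrefl, if_false, sub_zero, Finset.sum_const, Finset.card_univ, nsmul_eq_mul,
      ← hndef, hq]
    field_simp
  set y := Real.log n * G.surplus with hy
  -- Testing with the identity gives `1 ≤ d ≤ 288 y + 1/4`; hence `96 y ≥ 1/4`, and `S = 384 y`
  -- absorbs the additive error.
  have hy0 : 3 / 4 ≤ 288 * y := by
    have h := hsdp 1 Matrix.PosSemidef.one (by simp)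
    have h1 : ∑ i, ∑ j, (q - G.adjMatrix ℝ i j) * (1 : Matrix V V ℝ) i j = B.trace := by
      simp [Matrix.one_apply, Matrix.trace, hB]
    rw [h1, htr] at h
    linarith
  have hq1 : 1 / 2 + ε ≤ q := by rw [hq, le_div_iff₀ hn0]; exact hd1
  have hq2 : q ≤ 1 - ε := by rw [hq, div_le_iff₀ hn0]; exact hd2
  have key := SpectralSurplus.pow_four_le_of_semidefinite_bound (B := B) (q := q) (ε := ε) (S := 384 * y)
    (by ext i j; simp [hB, SimpleGraph.adjMatrix_apply, G.adj_comm])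
    (by
      intro i
      have h2 : ∑ j, G.adjMatrix ℝ i j = (d : ℝ) := by
        rw [← hG i]
        simp [SimpleGraph.adjMatrix_apply, ← SimpleGraph.card_neighborFinset_eq_degree,
          SimpleGraph.neighborFinset_eq_filter]
      simp only [hB, Matrix.of_apply, Finset.sum_sub_distrib, h2, Finset.sum_const,
        Finset.card_univ, nsmul_eq_mul, ← hndef, hq]
      field_simp; ring)
    (by
      intro i j
      simp only [hB, Matrix.of_apply, SimpleGraph.adjMatrix_apply]
      rw [abs_le]
      split_ifs <;> constructor <;> linarith)
    (by
      intro i j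
      simp only [hB, Matrix.of_apply, SimpleGraph.adjMatrix_apply]
      split_ifs <;> ring)
    hε hq1 hq2 hpos (by rw [htr]; positivity) (by linarith)
    (fun X hX hX1 => (hsdp X hX hX1).trans (by linarith))
  rw [← hndef] at key
  have hn43 : (n ^ (4 / 3 : ℝ)) ^ 3 = n ^ 4 := by
    rw [← Real.rpow_natCast, ← Real.rpow_mul hn0.le, ← Real.rpow_natCast]; norm_num
  have hroot : ε ^ 3 / 16 * n ^ (4 / 3 : ℝ) ≤ 384 * y := by
    refine le_of_pow_le_pow_left₀ (n := 3) (by norm_num) (by linarith) (le_trans ?_ key)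
    rw [mul_pow, hn43, div_pow, ← pow_mul]
    gcongr
    norm_num
  -- The argument yields exponent `4/3`, more than is asked.
  have hexp : n ^ (5 / 4 : ℝ) ≤ n ^ (4 / 3 : ℝ) :=
    Real.rpow_le_rpow_of_exponent_le hn1 (by norm_num)
  rw [div_le_iff₀ hlog]
  have : ε ^ 3 / 16 * n ^ (5 / 4 : ℝ) ≤ ε ^ 3 / 16 * n ^ (4 / 3 : ℝ) := by gcongr
  linarith
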